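/- Let $L\ge 2$ and let $\mathcal V$ be a finite set of nodes partitioned into layers $\mathcal O_1,\dots,\mathcal O_L$, where $\mathcal O_1=\{S\}$ consists of a single source node and $\mathcal O_L$ is the set of destination nodes. For $1\le l\le L-1$ let $\rho_l:2^{\mathcal O_l}\times 2^{\mathcal O_{l+1}}\to[0,\infty)$ satisfy: (i) $\rho_l(U_1\cup U_2,V_1\cap V_2)+\rho_l(U_1\cap U_2,V_1\cup V_2)\le\rho_l(U_1,V_1)+\rho_l(U_2,V_2)$ for all $U_1,U_2\subseteq\mathcal O_l$ and $V_1,V_2\subseteq\mathcal O_{l+1}$; (ii) $\rho_l(U,V)\le\rho_l(U_1,V_1)$ whenever $U,U_1\subseteq\mathcal O_l$, $V,V_1\subseteq\mathcal O_{l+1}$ and $U\cup V\subseteq U_1\cup V_1$; (iii) $\rho_l(U,V)=0$ whenever $U=\emptyset$ or $V=\emptyset$. For a real function $f$ and a set $A$ of nodes write $f(A)=\sum_{v\in A}f(v)$. A node-flow is a function $f:\mathcal V\to[0,\infty)$ such that $f(V)-f(\mathcal O_l\setminus U)\le\rho_l(U,V)$ for all $1\le l\le L-1$, $U\subseteq\mathcal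 O_l$, $V\subseteq\mathcal O_{l+1}$, and $f(S)=f(\mathcal O_L)$. The cut function is $$C(\Omega)=\sum_{l=1}^{L-1}\rho_l(\Omega\cap\mathcal O_l,\ \mathcal O_{l+1}\setminus\Omega),\qquad \Omega\subseteq\mathcal V.$$ Let nonnegative values $f(v)$, $v\in\mathcal O_L$, be given. They are feasible, meaning that they extend to a node-flow on $\mathcal V$, if and only if $$f(\mathcal O_L\setminus\Omega)\le C(\Omega)\qquad\text{for all }\Omega\subseteq\mathcal V\text{ with }S\in\Omega.$$ -/

import Mathlib

/-- A layered graph on the finite node set `V`: the nodes are partitioned into the layers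
`1, …, L`. Edges only serve to ensure the layering and carry no further data. -/
structure LayeredGraph (V : Type*) where
  /-- the number of layers -/
  L : ℕ
  two_le_L : 2 ≤ L
  /-- the index of the layer that contains a node -/
  layer : V → ℕ
  one_le_layer : ∀ v, 1 ≤ layer v
  layer_le : ∀ v, layer v ≤ L

namespace LayeredGraph

/-- The set `O l` of the nodes in layer `l`. -/
def O {V : Type*} [Fintype V] (G : LayeredGraph V) (l : ℕ) : Finset V :=
  Finset.univ.filter (fun v => G.layer v = l)

/-- `ρ l`, for `1 ≤ l ≤ L - 1`, is a family of bisubmodular capacity functions, each defined on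
pairs `(A, B)` with `A ⊆ O l` and `B ⊆ O (l + 1)`. Values of `ρ` elsewhere are irrelevant. -/
structure IsBisubmodularCapacity {V : Type*} [Fintype V] [DecidableEq V] (G : LayeredGraph V)
    (ρ : ℕ → Finset V → Finset V → ℝ) : Prop where
  nonneg : ∀ l ∈ Finset.Ico 1 G.L, ∀ A ⊆ G.O l, ∀ B ⊆ G.O (l + 1), 0 ≤ ρ l A B
  bisubmodular : ∀ l ∈ Finset.Ico 1 G.L,
    ∀ A₁ ⊆ G.O l, ∀ A₂ ⊆ G.O l, ∀ B₁ ⊆ G.O (l + 1), ∀ B₂ ⊆ G.O (l + 1),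
      ρ l (A₁ ∪ A₂) (B₁ ∩ B₂) + ρ l (A₁ ∩ A₂) (B₁ ∪ B₂) ≤ ρ l A₁ B₁ + ρ l A₂ B₂
  mono : ∀ l ∈ Finset.Ico 1 G.L,
    ∀ A ⊆ G.O l, ∀ A₁ ⊆ G.O l, ∀ B ⊆ G.O (l + 1), ∀ B₁ ⊆ G.O (l + 1),
      A ∪ B ⊆ A₁ ∪ B₁ → ρ l A B ≤ ρ l A₁ B₁
  empty_left : ∀ l ∈ Finset.Ico 1 G.L, ∀ B ⊆ G.O (l + 1), ρ l ∅ B = 0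
  empty_right : ∀ l ∈ Finset.Ico 1 G.L, ∀ A ⊆ G.O l, ρ l A ∅ = 0

/-- A node-flow: a nonnegative function on the nodes that satisfies the capacity constraints
`f(B) - f(O_l \ A) ≤ ρ_l(A, B)`, and for which the last layer sinks the flow of the first. -/
structure IsNodeFlow {V : Type*} [Fintype V] [DecidableEq V] (G : LayeredGraph V)
    (ρ : ℕ → Finset V → Finset V → ℝ) (f : V → ℝ) : Prop where
  nonneg : ∀ v, 0 ≤ f v
  capacity : ∀ l ∈ Finset.Ico 1 G.L, ∀ A ⊆ G.O l, ∀ B ⊆ G.O (l + 1),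
    ∑ v ∈ B, f v - ∑ v ∈ G.O l \ A, f v ≤ ρ l A B
  sink : ∑ v ∈ G.O 1, f v = ∑ v ∈ G.O G.L, f v

/-- The cut function `C(Ω) = ∑_{l=1}^{L-1} ρ_l(Ω ∩ O_l, O_{l+1} \ Ω)`. -/
def cut {V : Type*} [Fintype V] [DecidableEq V] (G : LayeredGraph V)
    (ρ : ℕ → Finset V → Finset V → ℝ) (Ω : Finset V) : ℝ :=
  ∑ l ∈ Finset.Ico 1 G.L, ρ l (Ω ∩ G.O l) (G.O (l + 1) \ Ω)

/-- The prescribed values `d v`, for `v` in the last layer, are feasible: some node-flow takes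
these values there. -/
def FeasibleAtDestinations {V : Type*} [Fintype V] [DecidableEq V] (G : LayeredGraph V)
    (ρ : ℕ → Finset V → Finset V → ℝ) (d : V → ℝ) : Prop :=
  ∃ f : V → ℝ, G.IsNodeFlow ρ f ∧ ∀ v ∈ G.O G.L, f v = d v

end LayeredGraph

/-! Necessity telescopes the capacity constraints for `Ω ∩ O l` and `O (l + 1) \ Ω` over the layers.
For sufficiency, the flow is built backwards from the destinations. Given values `e` on layer `m +
1`, values `f` on layer `m` must satisfy `e(B) - ρ m (O m \ Y) B ≤ f(Y)` for all `B`, and `f(Y)`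
must be at most the cut of the first `m` layers for every `Ω` disjoint from `Y`. The lower bounds
uncross supermodularly, the upper ones submodularly, and the cut condition on layer `m + 1` makes
them compatible, so `exists_modular_between` yields `f` (`exists_previous_layer`). The penalty `D`,
the total demand, extends the cut condition to sets `Ω` without `S`; `Ω = ∅` then keeps the total
flow at most `D`. -/

/-- **Discrete sandwich theorem.** Let `U X r` and `L X r` be the constraints `f(X) ≤ r` and
`r ≤ f(X)` on a modular function `f`. If the upper constraints are closed under submodular
uncrossing, the lower ones under supermodular uncrossing, and they are pairwise compatible, then
some modular function on the subsets of `E` satisfies all of them. -/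
theorem exists_modular_between {α : Type*} [DecidableEq α] (E : Finset α)
    (U L : Finset α → ℝ → Prop)
    (hUne : ∀ X ⊆ E, ∃ r, U X r) (hLne : ∀ X ⊆ E, ∃ r, L X r)
    (hU : ∀ X ⊆ E, ∀ Y ⊆ E, ∀ r s, U X r → U Y s →
      ∃ p q, U (X ∪ Y) p ∧ U (X ∩ Y) q ∧ p + q ≤ r + s)
    (hL : ∀ X ⊆ E, ∀ Y ⊆ E, ∀ r s, L X r → L Y s →
      ∃ p q, L (X ∪ Y) p ∧ L (X ∩ Y) q ∧ r + s ≤ p + q)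
    (hLU : ∀ X ⊆ E, ∀ r s, L X r → U X s → r ≤ s)
    (hU0 : U ∅ 0) (hL0 : L ∅ 0) :
    ∃ f : α → ℝ, ∀ X ⊆ E, (∀ r, U X r → ∑ v ∈ X, f v ≤ r) ∧ ∀ r, L X r → r ≤ ∑ v ∈ X, f v := by
  induction E using Finset.induction_on generalizing U L with
  | empty =>
    refine ⟨0, fun X hX => ?_⟩
    obtain rfl := Finset.subset_empty.1 hX
    simp only [Finset.sum_empty]
    exact ⟨fun r hr => hLU _ hX _ _ hL0 hr, fun r hr => hLU _ hX _ _ hr hU0⟩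
  | insert a E ha ih =>
    have sub : ∀ {X}, X ⊆ E → X ⊆ insert a E := fun h => h.trans (Finset.subset_insert _ _)
    have ins : ∀ {X}, X ⊆ E → insert a X ⊆ insert a E := fun h => Finset.insert_subset_insert a h
    have uni : ∀ {X Y : Finset α}, X ⊆ E → Y ⊆ E → X ∪ Y ⊆ E := Finset.union_subset
    have int : ∀ {X Y : Finset α}, X ⊆ E → X ∩ Y ⊆ E :=
      fun h => Finset.inter_subset_left.trans h
    have nm : ∀ {X}, X ⊆ E → a ∉ X := fun h h' => ha (h h')
    -- `t` is the value of `f` at `a`. Uncrossing one set containing `a` with one avoiding it, once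
    -- for `L` and once for `U`, shows that the bounds on `t` are consistent.
    obtain ⟨t, htl, htu⟩ : ∃ t, (∀ X ⊆ E, ∀ r s, L (insert a X) r → U X s → r - s ≤ t) ∧
        ∀ X ⊆ E, ∀ r s, U (insert a X) r → L X s → t ≤ r - s := by
      obtain ⟨t, h1, h2⟩ := exists_between_of_forall_le
        (s := {x : ℝ | ∃ X ⊆ E, ∃ r s, L (insert a X) r ∧ U X s ∧ x = r - s})
        (t := {x : ℝ | ∃ X ⊆ E, ∃ r s, U (insert a X) r ∧ L X s ∧ x = r - s})
        (by
          obtain ⟨r, hr⟩ := hLne (insert a ∅) (ins (Finset.empty_subset _))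
          exact ⟨_, ∅, Finset.empty_subset _, r, 0, hr, hU0, rfl⟩)
        (by
          obtain ⟨r, hr⟩ := hUne (insert a ∅) (ins (Finset.empty_subset _))
          exact ⟨_, ∅, Finset.empty_subset _, r, 0, hr, hL0, rfl⟩)
        (by
          rintro _ ⟨X, hX, r, s, hr, hs, rfl⟩ _ ⟨Y, hY, r', s', hr', hs', rfl⟩
          obtain ⟨p, q, hp, hq, hpq⟩ := hL _ (ins hX) _ (sub hY) _ _ hr hs'
          obtain ⟨p', q', hp', hq', hpq'⟩ := hU _ (sub hX) _ (ins hY) _ _ hs hr'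
          rw [Finset.insert_union] at hp
          rw [Finset.insert_inter_of_notMem (nm hY)] at hq
          rw [Finset.union_insert] at hp'
          rw [Finset.inter_insert_of_notMem (nm hX)] at hq'
          have := hLU _ (ins (uni hX hY)) _ _ hp hp'
          have := hLU _ (sub (int hX)) _ _ hq hq'
          linarith)
      exact ⟨t, fun X hX r s hr hs => h1 ⟨X, hX, r, s, hr, hs, rfl⟩,
        fun X hX r s hr hs => h2 ⟨X, hX, r, s, hr, hs, rfl⟩⟩
    -- With `f a = t` fixed, a bound on `insert a X` becomes one on `X`, shifted by `t`. The
    -- enlarged families still uncross; `P` is `≤` or `≥`, to treat `U` and `L` at once.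
    have cross : ∀ (W : Finset α → ℝ → Prop) {P : ℝ → ℝ → Prop}
        (_ : ∀ x y c, P (x + c) (y + c) → P x y)
        (_ : ∀ X ⊆ insert a E, ∀ Y ⊆ insert a E, ∀ r s, W X r → W Y s →
          ∃ p q, W (X ∪ Y) p ∧ W (X ∩ Y) q ∧ P (p + q) (r + s)),
        ∀ X ⊆ E, ∀ Y ⊆ E, ∀ r s, (W X r ∨ W (insert a X) (r + t)) →
          (W Y s ∨ W (insert a Y) (s + t)) →
          ∃ p q, (W (X ∪ Y) p ∨ W (insert a (X ∪ Y)) (p + t)) ∧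
            (W (X ∩ Y) q ∨ W (insert a (X ∩ Y)) (q + t)) ∧ P (p + q) (r + s) := by
      intro W P hP hW X hX Y hY r s hr hs
      rcases hr with hr | hr <;> rcases hs with hs | hs
      · obtain ⟨p, q, hp, hq, h⟩ := hW _ (sub hX) _ (sub hY) _ _ hr hs
        exact ⟨p, q, .inl hp, .inl hq, h⟩
      · obtain ⟨p, q, hp, hq, h⟩ := hW _ (sub hX) _ (ins hY) _ _ hr hs
        rw [Finset.union_insert] at hp
        rw [Finset.inter_insert_of_notMem (nm hX)] at hq
        refine ⟨p - t, q, .inr (by simpa using hp), .inl hq, hP _ _ t ?_⟩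
        convert h using 1 <;> ring
      · obtain ⟨p, q, hp, hq, h⟩ := hW _ (ins hX) _ (sub hY) _ _ hr hs
        rw [Finset.insert_union] at hp
        rw [Finset.insert_inter_of_notMem (nm hY)] at hq
        refine ⟨p - t, q, .inr (by simpa using hp), .inl hq, hP _ _ t ?_⟩
        convert h using 1 <;> ring
      · obtain ⟨p, q, hp, hq, h⟩ := hW _ (ins hX) _ (ins hY) _ _ hr hs
        rw [← Finset.insert_union_distrib] at hp
        rw [← Finset.insert_inter_distrib] at hq
        refine ⟨p - t, q - t, .inr (by simpa using hp), .inr (by simpa using hq),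
          hP _ _ (t + t) ?_⟩
        convert h using 1 <;> ring
    obtain ⟨f, hf⟩ := ih (fun X r => U X r ∨ U (insert a X) (r + t))
      (fun X r => L X r ∨ L (insert a X) (r + t))
      (fun X hX => (hUne X (sub hX)).imp fun _ => .inl)
      (fun X hX => (hLne X (sub hX)).imp fun _ => .inl)
      (cross U (P := fun x y => x ≤ y) (fun _ _ _ h => by linarith) hU)
      (cross L (P := fun x y => y ≤ x) (fun _ _ _ h => by linarith) hL)
      (by
        rintro X hX r s (hr | hr) (hs | hs)
        · exact hLU _ (sub hX) _ _ hr hs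
        · linarith [htu X hX _ _ hs hr]
        · linarith [htl X hX _ _ hr hs]
        · linarith [hLU _ (ins hX) _ _ hr hs])
      (.inl hU0) (.inl hL0)
    have hsum : ∀ X ⊆ E, ∑ v ∈ X, Function.update f a t v = ∑ v ∈ X, f v := fun X hX =>
      Finset.sum_update_of_notMem (nm hX) _ _
    refine ⟨Function.update f a t, fun X hX => ?_⟩
    by_cases haX : a ∈ X
    · obtain ⟨Y, haY, rfl⟩ : ∃ Y, a ∉ Y ∧ insert a Y = X :=
        ⟨X.erase a, Finset.notMem_erase _ _, Finset.insert_erase haX⟩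
      have hY : Y ⊆ E := (Finset.insert_subset_insert_iff haY).1 hX
      rw [Finset.sum_insert haY, hsum Y hY, Function.update_self]
      refine ⟨fun r hr => ?_, fun r hr => ?_⟩
      · linarith [(hf Y hY).1 (r - t) (.inr (by simpa using hr))]
      · linarith [(hf Y hY).2 (r - t) (.inr (by simpa using hr))]
    · have hX' : X ⊆ E := (Finset.subset_insert_iff_of_notMem haX).1 hX
      rw [hsum X hX']
      exact ⟨fun r hr => (hf X hX').1 r (.inl hr), fun r hr => (hf X hX').2 r (.inl hr)⟩

namespace LayeredGraph

theorem mem_O {V : Type*} [Fintype V] {G : LayeredGraph V} {l : ℕ} {v : V} :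
    v ∈ G.O l ↔ G.layer v = l := by
  simp [O]

variable {V : Type*} [Fintype V] [DecidableEq V] {G : LayeredGraph V}
  {ρ : ℕ → Finset V → Finset V → ℝ}

/-- The part of the cut function that comes from the first `m` layers, plus a penalty `D` for
leaving out the source `S`. -/
def penalizedCut (G : LayeredGraph V) (ρ : ℕ → Finset V → Finset V → ℝ) (S : V) (D : ℝ) (m : ℕ)
    (Ω : Finset V) : ℝ :=
  ∑ l ∈ Finset.Ico 1 m, ρ l (Ω ∩ G.O l) (G.O (l + 1) \ Ω) + if S ∈ Ω then 0 else D

/-- Complementation in layer `l + 1` turns bisubmodularity of `ρ l` into submodularity in `Ω`; the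
penalty is modular. -/
theorem penalizedCut_submodular (hρ : G.IsBisubmodularCapacity ρ) (S : V) (D : ℝ) {m : ℕ}
    (hm : m ≤ G.L) (Ω₁ Ω₂ : Finset V) :
    G.penalizedCut ρ S D m (Ω₁ ∪ Ω₂) + G.penalizedCut ρ S D m (Ω₁ ∩ Ω₂) ≤
      G.penalizedCut ρ S D m Ω₁ + G.penalizedCut ρ S D m Ω₂ := by
  have h1 : ∑ l ∈ Finset.Ico 1 m, ρ l ((Ω₁ ∪ Ω₂) ∩ G.O l) (G.O (l + 1) \ (Ω₁ ∪ Ω₂)) +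
      ∑ l ∈ Finset.Ico 1 m, ρ l ((Ω₁ ∩ Ω₂) ∩ G.O l) (G.O (l + 1) \ (Ω₁ ∩ Ω₂)) ≤
      ∑ l ∈ Finset.Ico 1 m, ρ l (Ω₁ ∩ G.O l) (G.O (l + 1) \ Ω₁) +
      ∑ l ∈ Finset.Ico 1 m, ρ l (Ω₂ ∩ G.O l) (G.O (l + 1) \ Ω₂) := by
    rw [← Finset.sum_add_distrib, ← Finset.sum_add_distrib]
    refine Finset.sum_le_sum fun l hl => ?_
    have := hρ.bisubmodular l (Finset.Ico_subset_Ico_right hm hl)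
      (Ω₁ ∩ G.O l) Finset.inter_subset_right (Ω₂ ∩ G.O l) Finset.inter_subset_right
      (G.O (l + 1) \ Ω₁) Finset.sdiff_subset (G.O (l + 1) \ Ω₂) Finset.sdiff_subset
    rwa [← Finset.union_inter_distrib_right, ← Finset.inter_inter_distrib_right,
      ← Finset.sdiff_union_distrib, ← Finset.sdiff_inter_distrib_right] at this
  unfold penalizedCut
  by_cases h₁ : S ∈ Ω₁ <;> by_cases h₂ : S ∈ Ω₂ <;> simp [h₁, h₂, -Finset.inter_assoc] <;>
    linarith

theorem penalizedCut_nonneg (hρ : G.IsBisubmodularCapacity ρ) (S : V) {D : ℝ} (hD : 0 ≤ D)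
    {m : ℕ} (hm : m ≤ G.L) (Ω : Finset V) : 0 ≤ G.penalizedCut ρ S D m Ω := by
  refine add_nonneg (Finset.sum_nonneg fun l hl => ?_) (by split_ifs <;> simp [hD])
  exact hρ.nonneg l (Finset.Ico_subset_Ico_right hm hl) _ Finset.inter_subset_right _
    Finset.sdiff_subset

theorem penalizedCut_empty (hρ : G.IsBisubmodularCapacity ρ) (S : V) (D : ℝ) {m : ℕ}
    (hm : m ≤ G.L) : G.penalizedCut ρ S D m ∅ = D := by
  rw [penalizedCut, Finset.sum_eq_zero, if_neg (Finset.notMem_empty S), zero_add]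
  intro l hl
  rw [Finset.empty_inter]
  exact hρ.empty_left l (Finset.Ico_subset_Ico_right hm hl) _ Finset.sdiff_subset

theorem penalizedCut_univ (hρ : G.IsBisubmodularCapacity ρ) (S : V) (D : ℝ) {m : ℕ}
    (hm : m ≤ G.L) : G.penalizedCut ρ S D m Finset.univ = 0 := by
  rw [penalizedCut, Finset.sum_eq_zero, if_pos (Finset.mem_univ S), zero_add]
  intro l hl
  rw [Finset.sdiff_eq_empty_iff_subset.2 (Finset.subset_univ _)]
  exact hρ.empty_right l (Finset.Ico_subset_Ico_right hm hl) _ Finset.inter_subset_right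

/-- Replacing the part of `Ω` in the layer `m + 1` changes the cut only in its last summand. -/
theorem penalizedCut_succ_replace {S : V} (hS : G.layer S = 1) (D : ℝ) {m : ℕ} (hm : 1 ≤ m)
    (Ω : Finset V) {B : Finset V} (hB : B ⊆ G.O (m + 1)) :
    G.penalizedCut ρ S D (m + 1) (Ω \ G.O (m + 1) ∪ G.O (m + 1) \ B) =
      G.penalizedCut ρ S D m Ω + ρ m (Ω ∩ G.O m) B := by
  have hmem : ∀ v, G.layer v ≠ m + 1 → (v ∈ Ω \ G.O (m + 1) ∪ G.O (m + 1) \ B ↔ v ∈ Ω) := by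
    intro v hv
    simp [mem_O, hv]
  have hleft : ∀ l ≤ m, (Ω \ G.O (m + 1) ∪ G.O (m + 1) \ B) ∩ G.O l = Ω ∩ G.O l := by
    intro l hl
    ext v
    rw [Finset.mem_inter, Finset.mem_inter, mem_O]
    refine and_congr_left fun hv => hmem v (by omega)
  have hright : ∀ l < m, G.O (l + 1) \ (Ω \ G.O (m + 1) ∪ G.O (m + 1) \ B) = G.O (l + 1) \ Ω := by
    intro l hl
    ext v
    rw [Finset.mem_sdiff, Finset.mem_sdiff, mem_O]
    refine and_congr_right fun hv => not_congr (hmem v (by omega))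
  have hlast : G.O (m + 1) \ (Ω \ G.O (m + 1) ∪ G.O (m + 1) \ B) = B := by
    ext v
    have := @hB v
    simp only [Finset.mem_sdiff, Finset.mem_union]
    tauto
  simp only [penalizedCut, hmem S (by omega)]
  rw [Finset.sum_Ico_succ_top hm, hleft m le_rfl, hlast, Finset.sum_congr rfl fun l hl => by
    rw [hleft l (Finset.mem_Ico.1 hl).2.le, hright l (Finset.mem_Ico.1 hl).2]]
  ring

/-- Values on the layer `m + 1` that satisfy the cut condition can be pulled back to the
layer `m`. -/
theorem exists_previous_layer (hρ : G.IsBisubmodularCapacity ρ) {S : V} (hS : G.layer S = 1)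
    {m : ℕ} (hm : m ∈ Finset.Ico 1 G.L) {e : V → ℝ} {D : ℝ}
    (heD : ∑ v ∈ G.O (m + 1), e v = D)
    (hcut : ∀ Ω, ∑ v ∈ G.O (m + 1) \ Ω, e v ≤ G.penalizedCut ρ S D (m + 1) Ω) :
    ∃ f : V → ℝ, (∀ v ∈ G.O m, 0 ≤ f v) ∧ ∑ v ∈ G.O m, f v = D ∧
      (∀ Ω, ∑ v ∈ G.O m \ Ω, f v ≤ G.penalizedCut ρ S D m Ω) ∧
      ∀ A ⊆ G.O m, ∀ B ⊆ G.O (m + 1), ∑ v ∈ B, e v - ∑ v ∈ G.O m \ A, f v ≤ ρ m A B := by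
  obtain ⟨h1m, hmL⟩ := Finset.mem_Ico.1 hm
  have hlower : ∀ Y, ∃ B ⊆ G.O (m + 1), (0 : ℝ) = ∑ v ∈ B, e v - ρ m (G.O m \ Y) B := fun Y =>
    ⟨∅, Finset.empty_subset _, by rw [hρ.empty_right m hm _ Finset.sdiff_subset]; simp⟩
  obtain ⟨f, hf⟩ := exists_modular_between (G.O m)
    (fun X r => ∃ Ω, Disjoint X Ω ∧ r = G.penalizedCut ρ S D m Ω)
    (fun Y r => ∃ B ⊆ G.O (m + 1), r = ∑ v ∈ B, e v - ρ m (G.O m \ Y) B)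
    (fun X _ => ⟨_, ∅, Finset.disjoint_empty_right _, rfl⟩)
    (fun X _ => ⟨_, hlower X⟩)
    (by
      rintro X - Y - _ _ ⟨Ω₁, h₁, rfl⟩ ⟨Ω₂, h₂, rfl⟩
      refine ⟨_, _, ⟨Ω₁ ∩ Ω₂, ?_, rfl⟩, ⟨Ω₁ ∪ Ω₂, ?_, rfl⟩, ?_⟩
      · exact Finset.disjoint_union_left.2 ⟨h₁.mono_right Finset.inter_subset_left,
          h₂.mono_right Finset.inter_subset_right⟩
      · exact Finset.disjoint_union_right.2 ⟨h₁.mono_left Finset.inter_subset_left,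
          h₂.mono_left Finset.inter_subset_right⟩
      · rw [add_comm]
        exact penalizedCut_submodular hρ S D hmL.le Ω₁ Ω₂)
    (by
      rintro X - Y - _ _ ⟨B₁, h₁, rfl⟩ ⟨B₂, h₂, rfl⟩
      refine ⟨_, _, ⟨B₁ ∪ B₂, Finset.union_subset h₁ h₂, rfl⟩,
        ⟨B₁ ∩ B₂, Finset.inter_subset_left.trans h₁, rfl⟩, ?_⟩
      have := hρ.bisubmodular m hm (G.O m \ X) Finset.sdiff_subset (G.O m \ Y)
        Finset.sdiff_subset B₁ h₁ B₂ h₂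
      rw [← Finset.sdiff_union_distrib, ← Finset.sdiff_inter_distrib_right] at this
      linarith [Finset.sum_union_inter (s₁ := B₁) (s₂ := B₂) (f := e)])
    (by
      rintro X - _ _ ⟨B, hB, rfl⟩ ⟨Ω, hΩ, rfl⟩
      -- Compatibility: alter `Ω` on layer `m + 1` so that exactly `B` is left out there. As `X`
      -- misses `Ω`, monotonicity enlarges `Ω ∩ O m` to `O m \ X`.
      have h := hcut (Ω \ G.O (m + 1) ∪ G.O (m + 1) \ B)
      rw [penalizedCut_succ_replace hS D h1m Ω hB] at h
      have hBe : G.O (m + 1) \ (Ω \ G.O (m + 1) ∪ G.O (m + 1) \ B) = B := by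
        ext v
        have := @hB v
        simp only [Finset.mem_sdiff, Finset.mem_union]
        tauto
      rw [hBe] at h
      have hsub : Ω ∩ G.O m ⊆ G.O m \ X := fun v hv =>
        Finset.mem_sdiff.2 ⟨(Finset.mem_inter.1 hv).2,
          Finset.disjoint_right.1 hΩ (Finset.mem_inter.1 hv).1⟩
      have := hρ.mono m hm _ Finset.inter_subset_right _ Finset.sdiff_subset B hB B hB
        (Finset.union_subset_union_left hsub)
      linarith)
    ⟨Finset.univ, Finset.disjoint_empty_left _, (penalizedCut_univ hρ S D hmL.le).symm⟩
    (hlower ∅)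
  refine ⟨f, fun v hv => ?_, le_antisymm ?_ ?_, fun Ω => ?_, fun A hA B hB => ?_⟩
  -- The lower bound with `B = ∅` is `0`.
  · simpa using (hf {v} (Finset.singleton_subset_iff.2 hv)).2 0 (hlower _)
  · exact (hf _ subset_rfl).1 D
      ⟨∅, Finset.disjoint_empty_right _, (penalizedCut_empty hρ S D hmL.le).symm⟩
  · refine (hf _ subset_rfl).2 D ⟨G.O (m + 1), subset_rfl, ?_⟩
    rw [Finset.sdiff_self, hρ.empty_left m hm _ subset_rfl, heD, sub_zero]
  · exact (hf _ Finset.sdiff_subset).1 _ ⟨Ω, Finset.sdiff_disjoint, rfl⟩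
  · have := (hf (G.O m \ A) Finset.sdiff_subset).2 _ ⟨B, hB, rfl⟩
    rw [Finset.sdiff_sdiff_eq_self hA] at this
    linarith

/-- Induction on `m`: pull `e` back one layer, extend the result to a flow on the earlier layers,
then overwrite layer `m + 1` with `e`. -/
theorem exists_flow_of_cut (hρ : G.IsBisubmodularCapacity ρ) {S : V} (hS : G.layer S = 1)
    {D : ℝ} {m : ℕ} (h1m : 1 ≤ m) (hmL : m ≤ G.L) (e : V → ℝ)
    (he : ∀ v ∈ G.O m, 0 ≤ e v) (heD : ∑ v ∈ G.O m, e v = D)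
    (hcut : ∀ Ω, ∑ v ∈ G.O m \ Ω, e v ≤ G.penalizedCut ρ S D m Ω) :
    ∃ f : V → ℝ, (∀ v, 0 ≤ f v) ∧ (∀ l ∈ Finset.Ico 1 m, ∀ A ⊆ G.O l, ∀ B ⊆ G.O (l + 1),
      ∑ v ∈ B, f v - ∑ v ∈ G.O l \ A, f v ≤ ρ l A B) ∧
      ∑ v ∈ G.O 1, f v = D ∧ ∀ v ∈ G.O m, f v = e v := by
  induction m, h1m using Nat.le_induction generalizing e with
  | base =>
    refine ⟨fun v => if v ∈ G.O 1 then e v else 0, fun v => ?_, by simp, ?_, fun v hv => if_pos hv⟩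
    · dsimp only
      split_ifs with h
      exacts [he v h, le_rfl]
    · rw [← heD]
      exact Finset.sum_congr rfl fun v hv => if_pos hv
  | succ m h1m ih =>
    obtain ⟨g, hg0, hgD, hgcut, hgcap⟩ :=
      exists_previous_layer hρ hS (Finset.mem_Ico.2 ⟨h1m, hmL⟩) heD hcut
    obtain ⟨f, hf0, hfcap, hfD, hfg⟩ := ih (by omega) g hg0 hgD hgcut
    have hold : ∀ l ≤ m, ∀ A ⊆ G.O l,
        ∑ v ∈ A, (if v ∈ G.O (m + 1) then e v else f v) = ∑ v ∈ A, f v := by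
      refine fun l hl A hA => Finset.sum_congr rfl fun v hv => if_neg fun h => ?_
      have h1 := mem_O.1 (hA hv)
      have h2 := mem_O.1 h
      omega
    refine ⟨fun v => if v ∈ G.O (m + 1) then e v else f v, fun v => ?_, fun l hl A hA B hB => ?_,
      (hold 1 h1m _ subset_rfl).trans hfD, fun v hv => if_pos hv⟩
    · dsimp only
      split_ifs with h
      exacts [he v h, hf0 v]
    · obtain ⟨h1l, hlm⟩ := Finset.mem_Ico.1 hl
      rw [hold l (by omega) _ Finset.sdiff_subset]
      rcases Nat.lt_succ_iff_lt_or_eq.1 hlm with hlt | rfl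
      · rw [hold (l + 1) hlt B hB]
        exact hfcap l (Finset.mem_Ico.2 ⟨h1l, hlt⟩) A hA B hB
      · rw [Finset.sum_congr rfl fun v hv => if_pos (hB hv),
          Finset.sum_congr rfl fun v hv => hfg v (Finset.sdiff_subset hv)]
        exact hgcap A hA B hB

theorem IsNodeFlow.sum_sdiff_le_cut {f : V → ℝ} (hf : G.IsNodeFlow ρ f) {Ω : Finset V}
    (hΩ : G.O 1 ⊆ Ω) : ∑ v ∈ G.O G.L \ Ω, f v ≤ G.cut ρ Ω := by
  have htel := Finset.sum_Ico_sub (fun l => ∑ v ∈ G.O l \ Ω, f v)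
    (show 1 ≤ G.L by have := G.two_le_L; omega)
  rw [Finset.sdiff_eq_empty_iff_subset.2 hΩ, Finset.sum_empty, sub_zero] at htel
  rw [← htel]
  refine Finset.sum_le_sum fun l hl => ?_
  have := hf.capacity l hl (Ω ∩ G.O l) Finset.inter_subset_right (G.O (l + 1) \ Ω)
    Finset.sdiff_subset
  rwa [Finset.sdiff_inter_self_right] at this

end LayeredGraph

theorem mainTheorem8 {V : Type*} [Fintype V] [DecidableEq V] (G : LayeredGraph V)
    (ρ : ℕ → Finset V → Finset V → ℝ) (hρ : G.IsBisubmodularCapacity ρ)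
    (S : V) (hS : G.O 1 = {S})
    (d : V → ℝ) (hd : ∀ v ∈ G.O G.L, 0 ≤ d v) :
    G.FeasibleAtDestinations ρ d ↔
      ∀ Ω : Finset V, S ∈ Ω → ∑ v ∈ G.O G.L \ Ω, d v ≤ G.cut ρ Ω := by
  have hS1 : G.layer S = 1 := LayeredGraph.mem_O.1 (hS ▸ Finset.mem_singleton_self S)
  have hL := G.two_le_L
  constructor
  · rintro ⟨f, hf, hfd⟩ Ω hΩ
    rw [← Finset.sum_congr rfl fun v hv => hfd v (Finset.sdiff_subset hv)]
    exact hf.sum_sdiff_le_cut (by rwa [hS, Finset.singleton_subset_iff])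
  · intro hcut
    obtain ⟨f, hf0, hfcap, hfD, hfd⟩ := LayeredGraph.exists_flow_of_cut hρ hS1
      (by omega : 1 ≤ G.L) le_rfl d hd rfl (by
        intro Ω
        by_cases hΩ : S ∈ Ω
        · simpa [LayeredGraph.penalizedCut, LayeredGraph.cut, hΩ] using hcut Ω hΩ
        · have hsum : ∑ v ∈ G.O G.L \ Ω, d v ≤ ∑ v ∈ G.O G.L, d v :=
            Finset.sum_le_sum_of_subset_of_nonneg Finset.sdiff_subset fun v hv _ => hd v hv
          -- When `S ∉ Ω`, the penalty alone covers the demand; taking `D = 0` here shows that the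
          -- remaining sum is nonnegative.
          have := LayeredGraph.penalizedCut_nonneg hρ S le_rfl le_rfl Ω
          simp only [LayeredGraph.penalizedCut, hΩ, if_false] at this ⊢
          linarith)
    exact ⟨f, ⟨hf0, hfcap, hfD.trans (Finset.sum_congr rfl hfd).symm⟩, hfd⟩
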